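/- A \emph{nice Young function} is an even convex function $\Phi:\mathbb R\to[0,\infty)$ that vanishes only at $0$, with $\lim_{x\to+\infty}\Phi(x)=+\infty$, $\lim_{x\to+\infty}\Phi(x)/x=+\infty$ and $\Phi'(0)=0$. Its \emph{modification} is the function $H_\Phi:\mathbb R\to[0,\infty)$ given by $H_\Phi(x)=x^2$ if $|x|\le 1$ and $H_\Phi(x)=\Phi(|x|)/\Phi(1)$ if $|x|>1$. For a probability measure $\mu$ and a nonnegative $\mu$-integrable function $g$, put $\mathrm{Ent}_\mu(g)=\int g\log g\,d\mu-\left(\int g\,d\mu\right)\log\left(\int g\,d\mu\right)\in[0,+\infty]$. \textbf{Theorem.} Let $\Phi$ be a twice differentiable, strictly convex, nice Young function. Assume that on $(0,\infty)$ the function $\Phi(x)/x^2$ is non-decreasing and the functions $\Phi(x)/x^\theta$ and $\Phi'(x)/x^\eta$ are non-increasing, for some $\theta>2$ and $\eta>0$. Assume also that there exists $\Gamma\in\mathbb R$ such that $\Gamma\,\Phi(xy)\ge\Phi(x)\Phi(y)$ for all $x,y\ge 0$. Let $V:\mathbb R\to\mathbb R$ be a measurable function such that $d\mu(x)=e^{-V(x)}dx$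 is a probability measure on $\mathbb R$, and assume that $V$ is of class $C^2$ on some half-line $(A,+\infty)$, with (i) $\displaystyle\liminf_{x\to+\infty}V'(x)>0$; (ii) $\displaystyle -1<\liminf_{x\to+\infty}\frac{V''(x)}{V'(x)^2}\le\limsup_{x\to+\infty}\frac{V''(x)}{V'(x)^2}<\frac1{\max(\theta,\eta)}$; (iii) there exists a constant $\kappa\in(0,\infty)$ such that for every locally Lipschitz $f:\mathbb R\to\mathbb R$ with $\int f^2\,d\mu<\infty$, $$\mathrm{Ent}_\mu(f^2)\le\kappa\int_{\mathbb R}H_\Phi\!\left(\frac{f'}{f}\right)f^2\,d\mu$$ (both sides taken in $[0,+\infty]$, and the integrand being $0$ where $f=0$). Then $$\limsup_{x\to+\infty}\frac{V(x)}{\Phi\big(|V'(x)|\big)}<+\infty .$$ -/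

import Mathlib

open MeasureTheory Filter Set
open scoped Topology

/-- A nice Young function, taken as a finite even function on the whole line: convex, even,
nonnegative, tending to infinity at infinity, superlinear at infinity, with derivative `0` at the
origin, and vanishing exactly at the origin. -/
structure IsNiceYoung (Φ : ℝ → ℝ) : Prop where
  convex : ConvexOn ℝ univ Φ
  even : ∀ x, Φ (-x) = Φ x
  nonneg : ∀ x, 0 ≤ Φ x
  eq_zero_iff : ∀ x, Φ x = 0 ↔ x = 0
  tendsto_atTop : Tendsto Φ atTop atTop
  tendsto_div_atTop : Tendsto (fun x => Φ x / x) atTop atTop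
  hasDerivAt_zero : HasDerivAt Φ 0 0

/-- The modification `H_Φ` of `Φ`: `x ^ 2` for `|x| ≤ 1` and `Φ(|x|) / Φ(1)` for `|x| > 1`. -/
noncomputable def youngModification (Φ : ℝ → ℝ) (x : ℝ) : ℝ :=
  open Classical in if |x| ≤ 1 then x ^ 2 else Φ |x| / Φ 1

/-- The entropy `∫ g log g dμ - (∫ g dμ) log (∫ g dμ)` of a nonnegative integrable function `g`
with respect to a probability measure `μ`. The negative part of `g log g` is bounded, so if
`g log g` is not integrable, its integral is `+∞` and so is the entropy. -/
noncomputable def entropy (μ : Measure ℝ) (g : ℝ → ℝ) : EReal :=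
  open Classical in
  if Integrable (fun x => g x * Real.log (g x)) μ then
    ((∫ x, g x * Real.log (g x) ∂μ - (∫ x, g x ∂μ) * Real.log (∫ x, g x ∂μ) : ℝ) : EReal)
  else ⊤

/-- The measure `e^{-V(x)} dx` on the real line. -/
noncomputable def expMeasure (V : ℝ → ℝ) : Measure ℝ :=
  volume.withDensity (fun x => ENNReal.ofReal (Real.exp (-V x)))

/-- The modified logarithmic Sobolev inequality with function `H` for `μ`: for some finite `κ > 0`,
`Ent_μ(f ^ 2) ≤ κ ∫ H(f' / f) f ^ 2 dμ` for every locally Lipschitz `f` in `L²(μ)`, as an inequality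
in `[0, +∞]`. (Where `f` vanishes the integrand is `0`; almost everywhere there `f' = 0`.) -/
def SatisfiesModifiedLogSobolev (μ : Measure ℝ) (H : ℝ → ℝ) : Prop :=
  ∃ κ : ℝ, 0 < κ ∧ ∀ f : ℝ → ℝ, LocallyLipschitz f → Integrable (fun x => f x ^ 2) μ →
    entropy μ (fun x => f x ^ 2) ≤
      ((ENNReal.ofReal κ * ∫⁻ x, ENNReal.ofReal (H (deriv f x / f x) * f x ^ 2) ∂μ : ENNReal) :
        EReal)

/-! The modified log-Sobolev inequality is tested on a ramp `f` that vanishes before `x` and equals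
`1` after `x + L`, with `L = 1 / (2 V'(x))`. Since `f ^ 2` lives on `[x, ∞)`, its entropy is at
least `-G log μ[x, ∞)`, where `G = ∫ f ^ 2 dμ`. The condition `V'' ≤ V' ^ 2` keeps `V` within `1` of
`V(x)` on the ramp, so both `G` (from below) and `μ[x, x + L]` (from above) compare with `e^{-V(x)}
L`. The energy density is `O(Φ(V'(x)))` there and `0` elsewhere. Dividing gives `-log μ[x, ∞) ≤ C
Φ(V'(x))` (`neg_log_tail_le`). As `V' ≥ c > 0`, also `μ[x, ∞) ≤ e^{-V(x)} / c`, which turns this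
into a bound on `V(x)`. -/

/-- The entropy of a function supported in a set `S` is at least `-(∫ g) log μ(S)`. -/
theorem entropy_ge_neg_integral_mul_log (μ : Measure ℝ) [IsProbabilityMeasure μ] {S : Set ℝ}
    (hS : MeasurableSet S) {g : ℝ → ℝ} (hg : Integrable g μ) (hg0 : ∀ x, 0 ≤ g x)
    (hgS : ∀ x, x ∉ S → g x = 0) (hG : 0 < ∫ x, g x ∂μ) :
    ((-((∫ x, g x ∂μ) * Real.log (μ.real S)) : ℝ) : EReal) ≤ entropy μ g := by
  unfold entropy
  split_ifs with hint
  swap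
  · exact le_top
  rw [EReal.coe_le_coe_iff]
  set G := ∫ x, g x ∂μ with hGdef
  have hm : 0 < μ.real S := by
    refine lt_of_le_of_ne measureReal_nonneg fun h => ?_
    have h0 : μ S = 0 := by
      rw [eq_comm, measureReal_eq_zero_iff] at h
      exact h
    have : g =ᵐ[μ] 0 := by
      have h1 : ∀ᵐ x ∂μ, x ∉ S := measure_eq_zero_iff_ae_notMem.1 h0
      filter_upwards [h1] with x hx using hgS x hx
    rw [hGdef, integral_congr_ae this] at hG
    simp at hG
  set m := μ.real S with hmdef
  have ha : 0 < G / m := div_pos hG hm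
  -- The tangent line of `u log u` at `u = G / m`, the mean of `g` over `S`; after integration the
  -- last two terms cancel.
  have hpt : ∀ x, g x * Real.log (G / m) + g x - S.indicator (fun _ => G / m) x
      ≤ g x * Real.log (g x) := by
    intro x
    by_cases hx : x ∈ S
    · rw [indicator_of_mem hx]
      rcases (hg0 x).eq_or_lt with h | h
      · simp [← h, ha.le]
      · have h1 := Real.log_le_sub_one_of_pos (div_pos ha h)
        rw [Real.log_div ha.ne' h.ne'] at h1
        have h2 := mul_le_mul_of_nonneg_left h1 h.le
        have h3 : g x * (G / m / g x - 1) = G / m - g x := by field_simp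
        linarith
    · simp [hgS x hx, indicator_of_notMem hx]
  have hind : Integrable (S.indicator (fun _ => G / m)) μ := (integrable_const _).indicator hS
  have h1 := integral_mono (((hg.mul_const _).add hg).sub hind) hint hpt
  rw [integral_sub' ((hg.mul_const _).add hg) hind, integral_add' (hg.mul_const _) hg,
    integral_mul_const, integral_indicator_const _ hS, ← hGdef, ← hmdef, smul_eq_mul,
    Real.log_div hG.ne' hm.ne'] at h1
  have h2 : m * (G / m) = G := by field_simp
  linarith

/-! ### Growth of nice Young functions -/

namespace IsNiceYoung

variable {Φ : ℝ → ℝ}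

theorem pos (hΦ : IsNiceYoung Φ) {x : ℝ} (hx : x ≠ 0) : 0 < Φ x :=
  lt_of_le_of_ne (hΦ.nonneg x) fun h => hx ((hΦ.eq_zero_iff x).1 h.symm)

theorem mono (hΦ : IsNiceYoung Φ) {x y : ℝ} (hx : 0 < x) (hxy : x ≤ y) : Φ x ≤ Φ y := by
  have hy : 0 < y := hx.trans_le hxy
  obtain ⟨-, hconv⟩ := hΦ.convex
  have h := hconv (mem_univ (0 : ℝ)) (mem_univ y) (a := 1 - x / y) (b := x / y)
    (sub_nonneg.2 ((div_le_one hy).2 hxy)) (by positivity) (by ring)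
  have h0 : Φ 0 = 0 := (hΦ.eq_zero_iff 0).2 rfl
  simp only [smul_eq_mul, mul_zero, zero_add, h0, div_mul_cancel₀ x hy.ne'] at h
  refine h.trans ?_
  have := mul_le_mul_of_nonneg_right ((div_le_one hy).2 hxy) (hΦ.nonneg y)
  linarith

theorem map_mul_le_rpow_mul {θ : ℝ} (hθ : AntitoneOn (fun x => Φ x / x ^ θ) (Ioi 0))
    {a b : ℝ} (ha : 0 < a) (hb : 1 ≤ b) : Φ (b * a) ≤ b ^ θ * Φ a := by
  have hb0 : 0 < b := by linarith
  have h := hθ (mem_Ioi.2 ha) (mem_Ioi.2 (mul_pos hb0 ha)) (le_mul_of_one_le_left ha.le hb)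
  simp only at h
  rw [Real.mul_rpow hb0.le ha.le, div_le_div_iff₀ (by positivity) (by positivity)] at h
  have : 0 < a ^ θ := by positivity
  refine le_of_mul_le_mul_right ?_ this
  linarith

/-- Away from `0` the quadratic branch is at most `1 ≤ Φ y / Φ c`, so a multiple of `Φ` dominates
both branches. -/
theorem youngModification_le (hΦ : IsNiceYoung Φ) {c y : ℝ} (hc : 0 < c) (hy : c ≤ y) :
    youngModification Φ y ≤ (1 / Φ 1 + 1 / Φ c) * Φ y := by
  have h1 : 0 < Φ 1 := hΦ.pos one_ne_zero
  have h2 : 0 < Φ c := hΦ.pos hc.ne'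
  have hy0 : 0 < y := hc.trans_le hy
  have h3 : 0 < Φ y := hΦ.pos hy0.ne'
  unfold youngModification
  rw [abs_of_pos hy0, add_mul]
  split_ifs with h
  · have h4 : 1 ≤ 1 / Φ c * Φ y := by
      rw [one_div_mul_eq_div, one_le_div h2]
      exact hΦ.mono hc hy
    have : 0 ≤ 1 / Φ 1 * Φ y := by positivity
    nlinarith
  · have : 0 ≤ 1 / Φ c * Φ y := by positivity
    rw [one_div_mul_eq_div]
    linarith

end IsNiceYoung

/-! ### The test function and its energy density -/

/-- The function equal to `0` before `x`, to `1` after `x + L`, and to `((t - x) / L) ^ k` between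
these points. -/
noncomputable def powerRamp (x L : ℝ) (k : ℕ) (t : ℝ) : ℝ :=
  (max 0 (min 1 ((t - x) / L))) ^ k

namespace powerRamp

variable {x L : ℝ} {k : ℕ}

theorem locallyLipschitz (x L : ℝ) (k : ℕ) : LocallyLipschitz (powerRamp x L k) := by
  have h1 : LocallyLipschitz fun t : ℝ => (t - x) / L :=
    ContDiff.locallyLipschitz (𝕂 := ℝ) (by fun_prop)
  have h2 : LocallyLipschitz fun t : ℝ => t ^ k :=
    ContDiff.locallyLipschitz (𝕂 := ℝ) (by fun_prop)
  exact h2.comp ((h1.const_min 1).const_max 0)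

theorem nonneg (t : ℝ) : 0 ≤ powerRamp x L k t := pow_nonneg (le_max_left _ _) _

theorem le_one (t : ℝ) : powerRamp x L k t ≤ 1 :=
  pow_le_one₀ (le_max_left _ _) (max_le zero_le_one (min_le_left _ _))

theorem eq_zero (hL : 0 < L) (hk : k ≠ 0) {t : ℝ} (ht : t ≤ x) : powerRamp x L k t = 0 := by
  have : (t - x) / L ≤ 0 := div_nonpos_of_nonpos_of_nonneg (by linarith) hL.le
  rw [powerRamp, max_eq_left ((min_le_right _ _).trans this), zero_pow hk]

theorem eq_one (hL : 0 < L) {t : ℝ} (ht : x + L ≤ t) : powerRamp x L k t = 1 := by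
  have : 1 ≤ (t - x) / L := by rw [one_le_div hL]; linarith
  rw [powerRamp, min_eq_left this, max_eq_right zero_le_one, one_pow]

theorem eq_pow (hL : 0 < L) {t : ℝ} (ht : x ≤ t) (ht' : t ≤ x + L) :
    powerRamp x L k t = ((t - x) / L) ^ k := by
  have h1 : (t - x) / L ≤ 1 := by rw [div_le_one hL]; linarith
  have h2 : 0 ≤ (t - x) / L := div_nonneg (by linarith) hL.le
  rw [powerRamp, min_eq_right h1, max_eq_right h2]

theorem deriv_eq_zero (hL : 0 < L) {t : ℝ} (ht : x + L < t) : deriv (powerRamp x L k) t = 0 := by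
  have : powerRamp x L k =ᶠ[𝓝 t] fun _ => 1 := by
    filter_upwards [Ioi_mem_nhds ht] with s hs using eq_one hL (mem_Ioi.1 hs).le
  rw [this.deriv_eq, deriv_const]

theorem deriv_div_self (hL : 0 < L) (hk : k ≠ 0) {t : ℝ} (ht : x < t) (ht' : t < x + L) :
    deriv (powerRamp x L k) t / powerRamp x L k t = k / (t - x) := by
  have h1 : powerRamp x L k =ᶠ[𝓝 t] fun s => ((s - x) / L) ^ k := by
    filter_upwards [Ioo_mem_nhds ht ht'] with s hs using eq_pow hL hs.1.le hs.2.le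
  have h2 : HasDerivAt (fun s => ((s - x) / L) ^ k) (k * ((t - x) / L) ^ (k - 1) * (1 / L)) t :=
    (((hasDerivAt_id t).sub_const x).div_const L).pow k
  have h3 : 0 < t - x := by linarith
  rw [h1.deriv_eq, h2.deriv, h1.self_of_nhds]
  obtain ⟨n, rfl⟩ := Nat.exists_eq_succ_of_ne_zero hk
  simp only [Nat.succ_sub_one, pow_succ]
  field_simp

end powerRamp

theorem youngModification_zero (Φ : ℝ → ℝ) : youngModification Φ 0 = 0 := by
  simp [youngModification]

/-- The energy density of the ramp of width `(2 a)⁻¹` is at most a multiple of `Φ a`. -/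
theorem youngModification_powerRamp_le {Φ : ℝ → ℝ} (hΦ : IsNiceYoung Φ) {θ c a x t : ℝ} {k : ℕ}
    (hθ : AntitoneOn (fun x => Φ x / x ^ θ) (Ioi 0)) (hk : 1 ≤ k) (hkθ : θ ≤ k)
    (hc : 0 < c) (ha : c ≤ a) (ht : t ≠ x + 1 / (2 * a)) :
    youngModification Φ (deriv (powerRamp x (1 / (2 * a)) k) t / powerRamp x (1 / (2 * a)) k t) *
        powerRamp x (1 / (2 * a)) k t ^ 2 ≤
      (Icc x (x + 1 / (2 * a))).indicator
        (fun _ => (1 / Φ 1 + 1 / Φ c) * (2 * k) ^ θ * Φ a) t := by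
  have ha0 : 0 < a := hc.trans_le ha
  set L := 1 / (2 * a) with hLdef
  have hL : 0 < L := by positivity
  have hk0 : k ≠ 0 := by omega
  have h1 : 0 < Φ 1 := hΦ.pos one_ne_zero
  have h2 : 0 < Φ c := hΦ.pos hc.ne'
  have h3 : 0 < Φ a := hΦ.pos ha0.ne'
  have hnn : 0 ≤ (Icc x (x + L)).indicator
        (fun _ => (1 / Φ 1 + 1 / Φ c) * (2 * k) ^ θ * Φ a) t :=
    indicator_nonneg (fun _ _ => by positivity) _
  rcases le_or_gt t x with htx | htx
  · rw [powerRamp.eq_zero hL hk0 htx]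
    simpa using hnn
  rcases lt_or_gt_of_ne ht with htL | htL
  swap
  · rw [powerRamp.deriv_eq_zero hL htL, zero_div, youngModification_zero, zero_mul]
    exact hnn
  rw [indicator_of_mem (mem_Icc.2 ⟨htx.le, htL.le⟩), powerRamp.deriv_div_self hL hk0 htx htL,
    powerRamp.eq_pow hL htx.le htL.le]
  set s := (t - x) / L with hs
  have hs0 : 0 < s := div_pos (by linarith) hL
  have hs1 : s ≤ 1 := by rw [hs, div_le_one hL]; linarith
  -- Since `L = 1 / (2 a)`, the logarithmic derivative is `a` times a factor at least `1`, which
  -- comes out of `Φ` as its `θ`-th power.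
  have htx' : k / (t - x) = (2 * k / s) * a := by
    have : t - x = s * L := by rw [hs]; field_simp
    rw [this, hLdef]
    field_simp
  have hk1 : (1 : ℝ) ≤ k := by exact_mod_cast hk
  have hb : 1 ≤ 2 * k / s := by
    rw [one_le_div hs0]; linarith
  have hle : youngModification Φ (k / (t - x)) ≤
      (1 / Φ 1 + 1 / Φ c) * ((2 * k / s) ^ θ * Φ a) := by
    rw [htx']
    refine (hΦ.youngModification_le hc (ha.trans (le_mul_of_one_le_left ha0.le hb))).trans ?_
    gcongr
    exact IsNiceYoung.map_mul_le_rpow_mul hθ ha0 hb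
  -- The choice `k ≥ θ` lets `f ^ 2` absorb the singularity `s ^ (-θ)` at the foot of the ramp.
  have hpow : (s ^ k) ^ 2 ≤ s ^ θ := by
    calc (s ^ k) ^ 2 ≤ s ^ k := pow_le_of_le_one (by positivity) (pow_le_one₀ hs0.le hs1) two_ne_zero
      _ = s ^ (k : ℝ) := (Real.rpow_natCast s k).symm
      _ ≤ s ^ θ := Real.rpow_le_rpow_of_exponent_ge hs0 hs1 hkθ
  calc _ ≤ (1 / Φ 1 + 1 / Φ c) * ((2 * k / s) ^ θ * Φ a) * s ^ θ := by
        gcongr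
    _ = _ := by
        rw [Real.div_rpow (by positivity) hs0.le]
        have : 0 < s ^ θ := by positivity
        field_simp

/-! ### Mass of half-lines and intervals -/

theorem expMeasure_Ici_le {V : ℝ → ℝ} {c x : ℝ} (hc : 0 < c)
    (hV : ∀ t, x ≤ t → V x + c * (t - x) ≤ V t) :
    expMeasure V (Ici x) ≤ ENNReal.ofReal (Real.exp (-V x) / c) := by
  rw [expMeasure, withDensity_apply _ measurableSet_Ici, ← restrict_Ioi_eq_restrict_Ici]
  have hint : IntegrableOn (fun t => Real.exp (-V x + c * x) * Real.exp (-c * t)) (Ioi x) :=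
    (integrableOn_exp_mul_Ioi (neg_lt_zero.2 hc) x).const_mul _
  calc _ ≤ ∫⁻ t in Ioi x, ENNReal.ofReal (Real.exp (-V x + c * x) * Real.exp (-c * t)) := by
        refine setLIntegral_mono' measurableSet_Ioi fun t ht => ?_
        rw [← Real.exp_add]
        gcongr
        have := hV t (mem_Ioi.1 ht).le
        linarith
    _ = ENNReal.ofReal (∫ t in Ioi x, Real.exp (-V x + c * x) * Real.exp (-c * t)) :=
        (ofReal_integral_eq_lintegral_ofReal hint (ae_of_all _ fun t => by positivity)).symm
    _ = _ := by
        rw [integral_const_mul, integral_exp_mul_Ioi (neg_lt_zero.2 hc), neg_div_neg_eq,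
          mul_div_assoc', ← Real.exp_add]
        ring_nf

theorem expMeasure_Icc_le {V : ℝ → ℝ} {a b v : ℝ} (hV : ∀ t ∈ Icc a b, v ≤ V t) :
    expMeasure V (Icc a b) ≤ ENNReal.ofReal (Real.exp (-v) * (b - a)) := by
  rw [expMeasure, withDensity_apply _ measurableSet_Icc, ENNReal.ofReal_mul (Real.exp_nonneg _),
    ← Real.volume_Icc, ← setLIntegral_const]
  refine setLIntegral_mono' measurableSet_Icc fun t ht => ?_
  gcongr
  exact hV t ht

theorem le_expMeasure_Icc {V : ℝ → ℝ} {a b v : ℝ} (hV : ∀ t ∈ Icc a b, V t ≤ v) :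
    ENNReal.ofReal (Real.exp (-v) * (b - a)) ≤ expMeasure V (Icc a b) := by
  rw [expMeasure, withDensity_apply _ measurableSet_Icc, ENNReal.ofReal_mul (Real.exp_nonneg _),
    ← Real.volume_Icc, ← setLIntegral_const]
  refine setLIntegral_mono' measurableSet_Icc fun t ht => ?_
  gcongr
  exact hV t ht

/-! ### Growth of the potential -/

/-- If `V'` is at least `c > 0` and `V'' ≤ V' ^ 2` on a half-line, then `V` increases by at most `1`
on an interval of length `(2 V'(x))⁻¹` after `x`. -/
theorem le_add_one_of_deriv_deriv_le {V : ℝ → ℝ} {B c x t : ℝ} (hc : 0 < c)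
    (hV : ∀ t, B < t → DifferentiableAt ℝ V t)
    (hV' : ∀ t, B < t → DifferentiableAt ℝ (deriv V) t)
    (hcV : ∀ t, B < t → c ≤ deriv V t)
    (hVV : ∀ t, B < t → deriv (deriv V) t / deriv V t ^ 2 ≤ 1)
    (hx : B < x) (hxt : x ≤ t) (ht : t ≤ x + 1 / (2 * deriv V x)) : V t ≤ V x + 1 := by
  have hpos : ∀ t, B < t → 0 < deriv V t := fun t ht => hc.trans_le (hcV t ht)
  have hx0 := hpos x hx
  have hd : ∀ s, B < s →
      HasDerivAt (fun u => (deriv V u)⁻¹ + u) (-deriv (deriv V) s / deriv V s ^ 2 + 1) s :=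
    fun s hs => ((hV' s hs).hasDerivAt.inv (hpos s hs).ne').add (hasDerivAt_id s)
  -- The derivative is `1 - V'' / V' ^ 2 ≥ 0`. Hence `1 / V'` drops by at most `1 / (2 V'(x))`, half
  -- its initial value, so `V'` at most doubles on the interval.
  have hmono : MonotoneOn (fun u => (deriv V u)⁻¹ + u) (Ici x) := by
    refine monotoneOn_of_deriv_nonneg (convex_Ici x)
      (fun s hs => (hd s (hx.trans_le hs)).continuousAt.continuousWithinAt)
      (fun s hs => ?_) (fun s hs => ?_)
    all_goals
      rw [interior_Ici, mem_Ioi] at hs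
    · exact (hd s (hx.trans hs)).differentiableAt.differentiableWithinAt
    · rw [(hd s (hx.trans hs)).deriv, neg_div]
      linarith [hVV s (hx.trans hs)]
  have hle : ∀ s, x ≤ s → s ≤ x + 1 / (2 * deriv V x) → deriv V s ≤ 2 * deriv V x := by
    intro s hs hs'
    have h := hmono self_mem_Ici (mem_Ici.2 hs) hs
    simp only at h
    have h1 : (deriv V x)⁻¹ = 1 / (2 * deriv V x) + (2 * deriv V x)⁻¹ := by field_simp; norm_num
    refine (inv_le_inv₀ (by positivity) (hpos s (hx.trans_le hs))).1 ?_
    linarith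
  have h := (convex_Icc x t).image_sub_le_mul_sub_of_deriv_le (f := V)
    (fun s hs => (hV s (hx.trans_le hs.1)).continuousAt.continuousWithinAt)
    (fun s hs => (hV s (hx.trans_le (interior_subset hs).1)).differentiableWithinAt)
    (C := 2 * deriv V x)
    (fun s hs => hle s (interior_subset hs).1 ((interior_subset hs).2.trans ht))
    x (left_mem_Icc.2 hxt) t (right_mem_Icc.2 hxt) hxt
  have h2 : 2 * deriv V x * (t - x) ≤ 2 * deriv V x * (1 / (2 * deriv V x)) := by
    gcongr; linarith
  have h3 : 2 * deriv V x * (1 / (2 * deriv V x)) = 1 := by field_simp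
  linarith

theorem add_mul_le_of_le_deriv {V : ℝ → ℝ} {B c x t : ℝ}
    (hV : ∀ t, B < t → DifferentiableAt ℝ V t) (hcV : ∀ t, B < t → c ≤ deriv V t)
    (hx : B < x) (hxt : x ≤ t) : V x + c * (t - x) ≤ V t := by
  have h := (convex_Icc x t).mul_sub_le_image_sub_of_le_deriv (f := V)
    (fun s hs => (hV s (hx.trans_le hs.1)).continuousAt.continuousWithinAt)
    (fun s hs => (hV s (hx.trans_le (interior_subset hs).1)).differentiableWithinAt)
    (fun s hs => hcV s (hx.trans_le (interior_subset hs).1))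
    x (left_mem_Icc.2 hxt) t (right_mem_Icc.2 hxt) hxt
  linarith

/-! ### Tail bound from the functional inequality -/

/-- The modified logarithmic Sobolev inequality, tested on a ramp, bounds the logarithm of the tail
of the measure by `Φ(V')`. -/
theorem neg_log_tail_le {Φ V : ℝ → ℝ} {θ c κ x a : ℝ} {k : ℕ} (hΦ : IsNiceYoung Φ)
    (hθ : AntitoneOn (fun x => Φ x / x ^ θ) (Ioi 0)) (hk : 1 ≤ k) (hkθ : θ ≤ k)
    (hc : 0 < c) (ha : c ≤ a) [IsProbabilityMeasure (expMeasure V)] (hκ : 0 < κ)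
    (hμ : ∀ f : ℝ → ℝ, LocallyLipschitz f → Integrable (fun x => f x ^ 2) (expMeasure V) →
      entropy (expMeasure V) (fun x => f x ^ 2) ≤
        ((ENNReal.ofReal κ * ∫⁻ x, ENNReal.ofReal
          (youngModification Φ (deriv f x / f x) * f x ^ 2) ∂(expMeasure V) : ENNReal) : EReal))
    (hlow : ∀ t ∈ Icc x (x + 1 / (2 * a)), V x ≤ V t)
    (hup : ∀ t ∈ Icc x (x + 1 / (2 * a)), V t ≤ V x + 1) :
    -Real.log ((expMeasure V).real (Ici x)) ≤
      κ * ((1 / Φ 1 + 1 / Φ c) * (2 * k) ^ θ) * (2 * 4 ^ k * Real.exp 1) * Φ a := by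
  have ha0 : 0 < a := hc.trans_le ha
  have hpt := fun t ht =>
    youngModification_powerRamp_le (x := x) (t := t) hΦ hθ hk hkθ hc ha ht
  set L := 1 / (2 * a) with hLdef
  have hL : 0 < L := by positivity
  have hk0 : k ≠ 0 := by omega
  have h1 : 0 < Φ 1 := hΦ.pos one_ne_zero
  have h2 : 0 < Φ c := hΦ.pos hc.ne'
  have h3 : 0 < Φ a := hΦ.pos ha0.ne'
  set K := (1 / Φ 1 + 1 / Φ c) * (2 * k) ^ θ * Φ a with hK
  have hK0 : 0 ≤ K := by positivity
  set μ := expMeasure V with hμdef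
  set f := powerRamp x L k with hf
  have hlip : LocallyLipschitz f := powerRamp.locallyLipschitz x L k
  have hf0 : ∀ t, 0 ≤ f t := fun t => powerRamp.nonneg t
  have hf1 : ∀ t, f t ≤ 1 := fun t => powerRamp.le_one t
  have hcont : Continuous fun t => f t ^ 2 := hlip.continuous.pow 2
  have hint : Integrable (fun t => f t ^ 2) μ := by
    refine Integrable.of_bound hcont.aestronglyMeasurable 1 (ae_of_all _ fun t => ?_)
    rw [Real.norm_of_nonneg (by positivity)]
    exact pow_le_one₀ (hf0 t) (hf1 t)
  have henergy : (∫⁻ t, ENNReal.ofReal (youngModification Φ (deriv f t / f t) * f t ^ 2) ∂μ) ≤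
      ENNReal.ofReal (K * (Real.exp (-V x) * L)) := by
    -- The upper corner of the ramp is a null set; at the lower corner the factor `f ^ 2` vanishes.
    have hae : ∀ᵐ t ∂μ, t ≠ x + L := by
      refine (withDensity_absolutelyContinuous _ _).ae_le ?_
      exact Measure.ae_ne volume (x + L)
    calc _ ≤ ∫⁻ t, (Icc x (x + L)).indicator (fun _ => ENNReal.ofReal K) t ∂μ := by
          refine lintegral_mono_ae ?_
          filter_upwards [hae] with t ht
          refine (ENNReal.ofReal_le_ofReal (hpt t ht)).trans (le_of_eq ?_)
          by_cases h : t ∈ Icc x (x + L)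
          · simp only [indicator_of_mem h]
          · simp only [indicator_of_notMem h, ENNReal.ofReal_zero]
      _ = ENNReal.ofReal K * μ (Icc x (x + L)) := lintegral_indicator_const measurableSet_Icc _
      _ ≤ ENNReal.ofReal K * ENNReal.ofReal (Real.exp (-V x) * L) := by
          gcongr
          refine (expMeasure_Icc_le hlow).trans (le_of_eq ?_)
          rw [add_sub_cancel_left]
      _ = _ := (ENNReal.ofReal_mul hK0).symm
  -- On the right half of the ramp `f ≥ 2 ^ (-k)`, and `V ≤ V x + 1`.
  have hmass : (1 / 4) ^ k * (Real.exp (-(V x + 1)) * (L / 2)) ≤ ∫ t, f t ^ 2 ∂μ := by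
    have hsub : Icc (x + L / 2) (x + L) ⊆ Icc x (x + L) := Icc_subset_Icc_left (by linarith)
    have hI : Real.exp (-(V x + 1)) * (L / 2) ≤ μ.real (Icc (x + L / 2) (x + L)) := by
      have h := le_expMeasure_Icc fun t ht => hup t (hsub ht)
      rw [ENNReal.ofReal_le_iff_le_toReal (measure_ne_top _ _)] at h
      refine le_of_eq_of_le ?_ h
      ring_nf
    calc _ ≤ (1 / 4 : ℝ) ^ k * μ.real (Icc (x + L / 2) (x + L)) := by gcongr
      _ = ∫ t, (Icc (x + L / 2) (x + L)).indicator (fun _ => (1 / 4 : ℝ) ^ k) t ∂μ := by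
          rw [integral_indicator_const _ measurableSet_Icc, smul_eq_mul, mul_comm]
      _ ≤ _ := by
          refine integral_mono ((integrable_const _).indicator measurableSet_Icc) hint fun t => ?_
          by_cases ht : t ∈ Icc (x + L / 2) (x + L)
          · rw [indicator_of_mem ht]
            simp only [hf]
            rw [powerRamp.eq_pow hL (hsub ht).1 (hsub ht).2, ← pow_mul, mul_comm k 2, pow_mul]
            have h2 : 1 / 2 ≤ (t - x) / L := by
              rw [le_div_iff₀ hL]; linarith [ht.1]
            gcongr
            nlinarith
          · rw [indicator_of_notMem ht]
            positivity
  have hG : 0 < ∫ t, f t ^ 2 ∂μ := lt_of_lt_of_le (by positivity) hmass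
  have hent := (entropy_ge_neg_integral_mul_log μ measurableSet_Ici hint (fun t => by positivity)
    (S := Ici x) (fun t ht => by
      simp only [hf]
      rw [powerRamp.eq_zero hL hk0 (not_le.1 ht).le, zero_pow two_ne_zero]) hG).trans
    (hμ f hlip hint)
  have hreal : -((∫ t, f t ^ 2 ∂μ) * Real.log (μ.real (Ici x))) ≤
      κ * (K * (Real.exp (-V x) * L)) := by
    rw [← EReal.coe_le_coe_iff]
    refine hent.trans ?_
    have : ENNReal.ofReal κ * (∫⁻ t, ENNReal.ofReal
        (youngModification Φ (deriv f t / f t) * f t ^ 2) ∂μ) ≤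
        ENNReal.ofReal (κ * (K * (Real.exp (-V x) * L))) := by
      rw [ENNReal.ofReal_mul hκ.le]
      gcongr
    refine (EReal.coe_ennreal_le_coe_ennreal_iff.2 this).trans (le_of_eq ?_)
    rw [EReal.coe_ennreal_ofReal, max_eq_left (by positivity)]
  have hlog : 0 ≤ -Real.log (μ.real (Ici x)) :=
    neg_nonneg.2 (Real.log_nonpos measureReal_nonneg measureReal_le_one)
  have h4 := mul_le_mul_of_nonneg_right hmass hlog
  have h5 : (1 / 4) ^ k * (Real.exp (-(V x + 1)) * (L / 2)) * -Real.log (μ.real (Ici x)) ≤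
      κ * (K * (Real.exp (-V x) * L)) := by linarith
  -- The factor `2 * 4 ^ k * e` is the ratio of `e^{-V(x)} L` to the lower bound for the mass, so
  -- `L` cancels.
  have h6 : κ * (K * (Real.exp (-V x) * L)) =
      (1 / 4) ^ k * (Real.exp (-(V x + 1)) * (L / 2)) *
        (κ * ((1 / Φ 1 + 1 / Φ c) * (2 * k) ^ θ) * (2 * 4 ^ k * Real.exp 1) * Φ a) := by
    have h7 : Real.exp (-V x) = Real.exp (-(V x + 1)) * Real.exp 1 := by
      rw [← Real.exp_add]; ring_nf
    rw [h7, hK, one_div_pow]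
    field_simp
  rw [h6] at h5
  exact le_of_mul_le_mul_left h5 (by positivity)

/-! ### Conclusion -/

theorem mainTheorem8 (Φ V : ℝ → ℝ) (θ η Γ : ℝ)
    (hΦ : IsNiceYoung Φ)
    (hΦ_strict : StrictConvexOn ℝ univ Φ)
    (hΦ_diff : Differentiable ℝ Φ)
    (hΦ_diff2 : Differentiable ℝ (deriv Φ))
    (hθ : 2 < θ) (hη : 0 < η)
    (hΦ_sq : MonotoneOn (fun x => Φ x / x ^ 2) (Ioi 0))
    (hΦ_theta : AntitoneOn (fun x => Φ x / x ^ θ) (Ioi 0))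
    (hΦ_eta : AntitoneOn (fun x => deriv Φ x / x ^ η) (Ioi 0))
    (hΦ_mul : ∀ x y : ℝ, 0 ≤ x → 0 ≤ y → Φ x * Φ y ≤ Γ * Φ (x * y))
    (hV_meas : AEMeasurable V volume)
    (hV_prob : IsProbabilityMeasure (expMeasure V))
    (hV_smooth : ∃ A : ℝ, ContDiffOn ℝ 2 V (Ioi A))
    (hV_deriv : 0 < liminf (fun x : ℝ => ((deriv V x : ℝ) : EReal)) atTop)
    (hV_lower : -1 < liminf
      (fun x : ℝ => ((deriv (deriv V) x / (deriv V x) ^ 2 : ℝ) : EReal)) atTop)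
    (hV_upper : limsup
      (fun x : ℝ => ((deriv (deriv V) x / (deriv V x) ^ 2 : ℝ) : EReal)) atTop
        < ((1 / max θ η : ℝ) : EReal))
    (hμ : SatisfiesModifiedLogSobolev (expMeasure V) (youngModification Φ)) :
    limsup (fun x : ℝ => ((V x / Φ |deriv V x| : ℝ) : EReal)) atTop < ⊤ := by
  obtain ⟨A, hA⟩ := hV_smooth
  obtain ⟨κ, hκ, hμ⟩ := hμ
  obtain ⟨c, hc, hcl⟩ := EReal.lt_iff_exists_real_btwn.1 hV_deriv
  have hc0 : 0 < c := by exact_mod_cast hc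
  have hmax : 1 / max θ η ≤ 1 := by
    rw [div_le_one (lt_max_of_lt_right hη)]
    exact le_max_of_le_left (by linarith)
  obtain ⟨B, hB⟩ := eventually_atTop.1
    ((eventually_gt_atTop A).and ((eventually_lt_of_lt_liminf hcl).and
      (eventually_lt_of_limsup_lt hV_upper)))
  have hcV : ∀ t, B < t → c ≤ deriv V t := fun t ht => by
    exact_mod_cast (hB t ht.le).2.1.le
  have hVV : ∀ t, B < t → deriv (deriv V) t / deriv V t ^ 2 ≤ 1 := fun t ht => by
    have : deriv (deriv V) t / deriv V t ^ 2 < 1 / max θ η := by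
      exact EReal.coe_lt_coe_iff.1 (hB t ht.le).2.2
    exact this.le.trans hmax
  have hdV : ∀ t, B < t → DifferentiableAt ℝ V t := fun t ht =>
    (hA.differentiableOn two_ne_zero).differentiableAt (Ioi_mem_nhds (hB t ht.le).1)
  have hA' : ContDiffOn ℝ 1 (deriv V) (Ioi A) := hA.deriv_of_isOpen isOpen_Ioi (by norm_num)
  have hdV' : ∀ t, B < t → DifferentiableAt ℝ (deriv V) t := fun t ht =>
    (hA'.differentiableOn one_ne_zero).differentiableAt (Ioi_mem_nhds (hB t ht.le).1)
  obtain ⟨k, hk⟩ := exists_nat_ge θ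
  have hk1 : 1 ≤ k := by
    have : (1 : ℝ) ≤ k := by linarith
    exact_mod_cast this
  set C := κ * ((1 / Φ 1 + 1 / Φ c) * (2 * k) ^ θ) * (2 * 4 ^ k * Real.exp 1) with hC
  have hΦc : 0 < Φ c := hΦ.pos hc0.ne'
  have hbound : ∀ x, B < x → V x / Φ |deriv V x| ≤ C + |Real.log c| / Φ c := by
    intro x hx
    have ha := hcV x hx
    have ha0 : 0 < deriv V x := hc0.trans_le ha
    have hgrow := fun t => add_mul_le_of_le_deriv (t := t) hdV hcV hx
    have hlog := neg_log_tail_le hΦ hΦ_theta hk1 hk hc0 ha hκ hμ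
      (fun t ht => by
        have := hgrow t ht.1
        have := mul_nonneg hc0.le (sub_nonneg.2 ht.1)
        linarith)
      (fun t ht => le_add_one_of_deriv_deriv_le hc0 hdV hdV' hcV hVV hx ht.1 ht.2)
    rw [← hC] at hlog
    -- Positivity matters: `Real.log 0 = 0` would break the monotonicity of the logarithm.
    have hpos : 0 < (expMeasure V).real (Ici x) := by
      have h := le_expMeasure_Icc (V := V) (a := x) (b := x + 1 / (2 * deriv V x)) fun t ht =>
        le_add_one_of_deriv_deriv_le hc0 hdV hdV' hcV hVV hx ht.1 ht.2
      refine ENNReal.toReal_pos (ne_of_gt ?_) (measure_ne_top _ _)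
      refine lt_of_lt_of_le ?_ (h.trans (measure_mono Icc_subset_Ici_self))
      rw [ENNReal.ofReal_pos, add_sub_cancel_left]
      positivity
    have htail : (expMeasure V).real (Ici x) ≤ Real.exp (-V x) / c :=
      ENNReal.toReal_le_of_le_ofReal (by positivity) (expMeasure_Ici_le hc0 hgrow)
    have h1 := Real.log_le_log hpos htail
    rw [Real.log_div (Real.exp_ne_zero _) hc0.ne', Real.log_exp] at h1
    have hΦle : Φ c ≤ Φ (deriv V x) := hΦ.mono hc0 ha
    rw [abs_of_pos ha0, div_le_iff₀ (hΦc.trans_le hΦle), add_mul]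
    -- The additive constant is absorbed because `Φ(V'(x)) ≥ Φ(c) > 0`.
    have h2 : |Real.log c| ≤ |Real.log c| / Φ c * Φ (deriv V x) := by
      rw [div_mul_eq_mul_div, le_div_iff₀ hΦc]
      gcongr
    linarith [neg_abs_le (Real.log c)]
  refine lt_of_le_of_lt ?_ (EReal.coe_lt_top (C + |Real.log c| / Φ c))
  refine limsup_le_of_le (by isBoundedDefault) ?_
  filter_upwards [eventually_gt_atTop B] with x hx
  exact_mod_cast hbound x hx
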